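/- Let $\mathbf A$ be a finite nonempty lattice algebra, i.e. a finite lattice $\langle A,\wedge,\vee\rangle$ with possibly further finitary operations (of any number and arities), and let $\tau$ be a finite relational vocabulary in which every symbol $R$ has arity $\tau(R)\ge 1$. Sentences of $\mathcal L^{\mathbf A}(\tau)$ are built from the symbols in $\tau$, variables, connectives for the operations of $\mathbf A$, and $\forall,\exists$. An $\mathbf A$-valued $\tau$-structure $\mathfrak M$ has a nonempty domain $M$ and maps $R^{\mathfrak M}\colon M^{\tau(R)}\to A$ for $R\in\tau$; the value $\|\varphi\|^{\mathfrak M}\in A$ of a sentence is defined inductively, connectives being interpreted by the operations of $\mathbf A$, and $\forall$, $\exists$ by infima and suprema in $A$. Given probability distributions $p_R\colon A\to(0,1]$ with $\sum_{a\in A}p_R(a)=1$ for each $R\in\tau$, let $$\mu_n(\varphi=a)=\sum_{\mathfrak M:\ \|\varphi\|^{\mathfrak M}=a}\ \prod_{R\in\tau}\ \prod_{\bar\imath\in[n]^{\tau(R)}}p_R\big(R^{\mathfrak M}(\bar\imath)\big),$$ the sum being over the $\mathbf A$-valued $\tau$-structures $\mathfrak M$ with domain $[n]=\{1,\dots,n\}$,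 $n\ge 1$ (for $p_R(a)=1/|A|$ this is the proportion of those structures in which $\varphi$ has value $a$). To an $\mathbf A$-valued $\tau$-structure $\mathfrak M$ corresponds the classical structure $\mathfrak M_{\tau\times A}$ with the same domain in the vocabulary $\tau\times A=\{R^a : R\in\tau,\ a\in A\}$, where $R^a$ is interpreted as $\{\bar m : R^{\mathfrak M}(\bar m)=a\}$. Let $\mathbb K$ be the class of classical $(\tau\times A)$-structures in which, for every $R\in\tau$, each $\tau(R)$-tuple satisfies $R^a$ for exactly one $a\in A$. A countable member of $\mathbb K$ is called a countable random model of $\mathbb K$ if it satisfies all extension axioms: for every $k\ge 0$ and every function $f\colon F_{k+1}\to A$, where $F_{k+1}$ is the set of atomic $\tau$-formulas in the variables $x_1,\dots,x_{k+1}$ in which $x_{k+1}$ occurs, any distinct elements $x_1,\dots,x_k$ can be extended by an element $x_{k+1}\neq x_1,\dots,x_k$ such that $R^{f(\psi)}(x_{i_1},\dots,x_{i_{\tau(R)}})$ holds for every $\psi=R(x_{i_1},\dots,x_{i_{\tau(R)}})\in F_{k+1}$. Then there is a countable $\mathbf A$-valued $\tau$-structure $\mathfrak R$, not depending on the distributions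 $p_R$, such that: 1. $\mathfrak R_{\tau\times A}$ is a countable random model of $\mathbb K$, and every countable random model of $\mathbb K$ is isomorphic to it; 2. for all distributions $p_R$ as above, every sentence $\varphi\in\mathcal L^{\mathbf A}(\tau)$ and every $a\in A$, $$\lim_{n\to\infty}\mu_n(\varphi=a)=1\quad\Longleftrightarrow\quad\|\varphi\|^{\mathfrak R}=a .$$ -/

import Mathlib

namespace ManyValued

universe u v w x

/-- A lattice algebra: a lattice `A` together with, for each `k`, an operation `A ^ k → A` for every
additional `k`-ary connective `c : C k`. The signature consists of `∧`, `∨` and the symbols in `C`. -/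
class LatticeAlgebra (C : ℕ → Type u) (A : Type v) extends Lattice A where
  op : ∀ {k : ℕ}, C k → (Fin k → A) → A

/-- Formulas whose free variables are among `x 0, …, x (n - 1)`, for a relational vocabulary
`τ` with arities `ar` and additional connectives `C`. A quantifier applied to a formula in `n + 1`
variables binds the last one. Sentences are the formulas in `0` variables. -/
inductive Formula (C : ℕ → Type u) {τ : Type w} (ar : τ → ℕ) : ℕ → Type (max u w)
  | rel {n : ℕ} (R : τ) (t : Fin (ar R) → Fin n) : Formula C ar n
  | inf {n : ℕ} (φ ψ : Formula C ar n) : Formula C ar n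
  | sup {n : ℕ} (φ ψ : Formula C ar n) : Formula C ar n
  | conn {n k : ℕ} (c : C k) (φ : Fin k → Formula C ar n) : Formula C ar n
  | all {n : ℕ} (φ : Formula C ar (n + 1)) : Formula C ar n
  | ex {n : ℕ} (φ : Formula C ar (n + 1)) : Formula C ar n

abbrev Sentence (C : ℕ → Type u) {τ : Type w} (ar : τ → ℕ) : Type (max u w) :=
  Formula C ar 0

/-- An `A`-valued structure with domain `M`: a map `M ^ (ar R) → A` for each symbol `R`. -/
abbrev AStructure (A : Type v) {τ : Type w} (ar : τ → ℕ) (M : Type x) : Type (max v w x) :=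
  ∀ R : τ, (Fin (ar R) → M) → A

section Value

variable {A : Type v} [Lattice A] [Finite A] {M : Type x} [Nonempty M]

/-- The supremum in a finite lattice of the values of a nonempty family. -/
noncomputable def supValue (f : M → A) : A :=
  (Set.toFinite (Set.range f)).toFinset.sup'
    ((Set.Finite.toFinset_nonempty _).2 (Set.range_nonempty f)) id

/-- The infimum in a finite lattice of the values of a nonempty family. -/
noncomputable def infValue (f : M → A) : A :=
  (Set.toFinite (Set.range f)).toFinset.inf'
    ((Set.Finite.toFinset_nonempty _).2 (Set.range_nonempty f)) id

theorem isLUB_supValue (f : M → A) : IsLUB (Set.range f) (supValue f) := by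
  constructor
  · intro b hb
    exact Finset.le_sup' id ((Set.Finite.mem_toFinset _).2 hb)
  · intro c hc
    exact Finset.sup'_le _ _ fun b hb => hc ((Set.Finite.mem_toFinset _).1 hb)

theorem isGLB_infValue (f : M → A) : IsGLB (Set.range f) (infValue f) := by
  constructor
  · intro b hb
    exact Finset.inf'_le id ((Set.Finite.mem_toFinset _).2 hb)
  · intro c hc
    exact Finset.le_inf' _ _ fun b hb => hc ((Set.Finite.mem_toFinset _).1 hb)

end Value

/-- The value `‖φ‖ (i 0, …, i (n - 1))` in the structure `S`. -/
noncomputable def Formula.value {C : ℕ → Type u} {A : Type v} [LatticeAlgebra C A] [Finite A]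
    {τ : Type w} {ar : τ → ℕ} {M : Type x} [Nonempty M] (S : AStructure A ar M) :
    {n : ℕ} → Formula C ar n → (Fin n → M) → A
  | _, .rel R t, i => S R (fun j => i (t j))
  | _, .inf φ ψ, i => φ.value S i ⊓ ψ.value S i
  | _, .sup φ ψ, i => φ.value S i ⊔ ψ.value S i
  | _, .conn c φ, i => LatticeAlgebra.op c (fun j => (φ j).value S i)
  | _, .all φ, i => infValue fun m => φ.value S (Fin.snoc i m)
  | _, .ex φ, i => supValue fun m => φ.value S (Fin.snoc i m)

/-- The value of a sentence in the structure `S`. -/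
noncomputable def Sentence.value {C : ℕ → Type u} {A : Type v} [LatticeAlgebra C A] [Finite A]
    {τ : Type w} {ar : τ → ℕ} {M : Type x} [Nonempty M] (S : AStructure A ar M)
    (φ : Sentence C ar) : A :=
  Formula.value S φ Fin.elim0

/-- The probability of an `A`-valued structure with finite domain `D` when each atomic statement
`R (i)` receives the value `a` with probability `p R a`, independently of the others. -/
noncomputable def structureProb {A : Type v} {τ : Type w} [Fintype τ] {ar : τ → ℕ}
    (p : τ → A → ℝ) {D : Type x} [Fintype D] (S : AStructure A ar D) : ℝ :=
  ∏ R : τ, ∏ i : Fin (ar R) → D, p R (S R i)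

open Classical in
/-- `μ_n (φ = a)` for the random structure with domain `Fin n`, where `n ≠ 0`. -/
noncomputable def mu {C : ℕ → Type u} {A : Type v} [LatticeAlgebra C A] [Fintype A]
    {τ : Type w} [Fintype τ] {ar : τ → ℕ} (p : τ → A → ℝ) (n : ℕ) [NeZero n]
    (φ : Sentence C ar) (a : A) : ℝ :=
  ∑ S : AStructure A ar (Fin n) with Sentence.value S φ = a, structureProb p S

/-- The classical relational language `τ × A`, with an `ar R`-ary symbol `R ^ a` for each `R : τ`
and `a : A`. -/
def classicalLanguage (A : Type v) {τ : Type w} (ar : τ → ℕ) : FirstOrder.Language :=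
  ⟨fun _ => Empty, fun n => {R : τ // ar R = n} × A⟩

/-- The symbol `R ^ a`. -/
def classicalSymbol {A : Type v} {τ : Type w} (ar : τ → ℕ) (R : τ) (a : A) :
    (classicalLanguage A ar).Relations (ar R) :=
  (⟨R, rfl⟩, a)

/-- The classical structure corresponding to an `A`-valued structure: `R ^ a` holds exactly of those
tuples at which `R` takes the value `a`. -/
@[reducible] def AStructure.toClassical {A : Type v} {τ : Type w} {ar : τ → ℕ} {M : Type x}
    (S : AStructure A ar M) : (classicalLanguage A ar).Structure M where
  funMap := fun c _ => nomatch c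
  RelMap := fun r i => S r.1.1 (fun j => i (Fin.cast r.1.2 j)) = r.2

/-- The class of those classical `τ × A`-structures in which every tuple satisfies `R ^ a` for some
`a`, and for no two distinct `a`. -/
structure InTranslatedClass {A : Type v} {τ : Type w} {ar : τ → ℕ} {M : Type x}
    (N : (classicalLanguage A ar).Structure M) : Prop where
  exists_value : ∀ (R : τ) (i : Fin (ar R) → M), ∃ a : A, N.RelMap (classicalSymbol ar R a) i
  not_two_values : ∀ (R : τ) (i : Fin (ar R) → M) (a b : A), a ≠ b →
    ¬ (N.RelMap (classicalSymbol ar R a) i ∧ N.RelMap (classicalSymbol ar R b) i)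

/-- The atomic `τ`-formulas in the variables `x 0, …, x k` in which the variable `x k` occurs. -/
def NewAtom {τ : Type w} (ar : τ → ℕ) (k : ℕ) : Type w :=
  {φ : Σ R : τ, (Fin (ar R) → Fin (k + 1)) // Fin.last k ∈ Set.range φ.2}

/-- The extension axiom for `k` and `f` holds in `N`: any distinct `x 0, …, x (k - 1)` can be
extended by some `y` distinct from them so that every new atomic formula `φ` satisfies
`φ ^ (f φ)`. -/
def SatisfiesExtensionAxiom {A : Type v} {τ : Type w} {ar : τ → ℕ} {M : Type x}
    (N : (classicalLanguage A ar).Structure M) (k : ℕ) (f : NewAtom ar k → A) : Prop :=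
  ∀ x : Fin k → M, Function.Injective x →
    ∃ y : M, (∀ i, y ≠ x i) ∧ ∀ φ : NewAtom ar k,
      N.RelMap (classicalSymbol ar φ.1.1 (f φ))
        (fun j => (Fin.snoc x y : Fin (k + 1) → M) (φ.1.2 j))

/-- `N` is a countable random model of the translated class: a countable member of the class that
satisfies all extension axioms. -/
structure IsCountableRandomModel {A : Type v} {τ : Type w} {ar : τ → ℕ} {M : Type x}
    (N : (classicalLanguage A ar).Structure M) : Prop where
  countable : Countable M
  mem_class : InTranslatedClass N
  extension : ∀ (k : ℕ) (f : NewAtom ar k → A), SatisfiesExtensionAxiom N k f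

end ManyValued

/-! Sentences of quantifier rank at most `K` cannot distinguish two structures satisfying the
extension axioms for all `k < K`. A partial isomorphism with fewer than `K` pairs extends by any
element of either side, so at each quantifier the sets of values on both sides coincide, and with
them their infima and suprema (`IsPartialIso.value_eq`). Between countable structures satisfying all
the axioms, iterating the same extension step gives an isomorphism (`exists_equiv_of_extends`). One
such structure is built on `ℕ` by letting each new element `m` carry out the `m`-th extension task
(`exists_structure_extends`).

In a random structure of size `n`, different candidates `y` for extending a fixed `k`-tuple involve
disjoint sets of atomic statements, so all fail with probability `(1 - c) ^ (n - k)`, where `c > 0`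
is a finite product of values of `p`. Summing over at most `n ^ k` tuples still gives a null
sequence. Hence almost surely the axioms below the rank of `φ` hold, and `φ` takes the value it has
in the random model. -/

namespace ManyValued

universe u v w x y

/-! ### Partial isomorphisms and back and forth -/

section PartialIsomorphism

variable {A : Type v} {τ : Type w} {ar : τ → ℕ} {M : Type x} {M' : Type y}

/-- The extension axiom for `k` and `f`, stated for an `A`-valued structure. -/
def AStructure.Extends (S : AStructure A ar M) (k : ℕ) (f : NewAtom ar k → A) : Prop :=
  ∀ x : Fin k → M, Function.Injective x →
    ∃ y : M, (∀ i, y ≠ x i) ∧ ∀ φ : NewAtom ar k,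
      S φ.1.1 (fun j => (Fin.snoc x y : Fin (k + 1) → M) (φ.1.2 j)) = f φ

theorem AStructure.inTranslatedClass_toClassical (S : AStructure A ar M) :
    InTranslatedClass S.toClassical where
  exists_value R i := ⟨S R i, rfl⟩
  not_two_values _ _ _ _ hab h := hab (h.1.symm.trans h.2)

/-- The `A`-valued structure that corresponds to a classical structure in the translated class. -/
theorem InTranslatedClass.exists_valued {N : (classicalLanguage A ar).Structure M}
    (h : InTranslatedClass N) :
    ∃ S : AStructure A ar M, ∀ R a i, N.RelMap (classicalSymbol ar R a) i ↔ S R i = a := by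
  choose S hS using h.exists_value
  refine ⟨S, fun R a i => ⟨fun ha => ?_, fun ha => ha ▸ hS R i⟩⟩
  by_contra hne
  exact h.not_two_values R i _ _ hne ⟨hS R i, ha⟩

/-- A set of pairs is a partial isomorphism if it is the graph of an injective partial map that
preserves the values of all symbols. -/
structure IsPartialIso (S : AStructure A ar M) (S' : AStructure A ar M') (s : Set (M × M')) :
    Prop where
  eq_iff : ∀ p ∈ s, ∀ q ∈ s, p.1 = q.1 ↔ p.2 = q.2
  map_rel : ∀ (R : τ) (t : Fin (ar R) → M × M'), (∀ j, t j ∈ s) →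
    S R (fun j => (t j).1) = S' R (fun j => (t j).2)

variable {S : AStructure A ar M} {S' : AStructure A ar M'} {s : Set (M × M')}

theorem IsPartialIso.swap (h : IsPartialIso S S' s) : IsPartialIso S' S (Prod.swap ⁻¹' s) where
  eq_iff _ hp _ hq := (h.eq_iff _ hp _ hq).symm
  map_rel R t ht := (h.map_rel R (fun j => (t j).swap) ht).symm

/-- Positive arity is essential: a nullary symbol could already take different values in `S` and
`S'`. -/
theorem IsPartialIso.empty (har : ∀ R, 0 < ar R) : IsPartialIso S S' ∅ where
  eq_iff _ hp := hp.elim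
  map_rel R _ ht := (ht ⟨0, har R⟩).elim

/-- The image of `m` comes from the extension axiom over the second coordinates, with `f` read off
from the values at `m` over the first ones. -/
theorem IsPartialIso.exists_insert_right (h : IsPartialIso S S' s) (hs : s.Finite)
    (hS' : ∀ f, S'.Extends s.ncard f) (m : M) :
    ∃ m' : M', IsPartialIso S S' (insert (m, m') s) := by
  by_cases hm : ∃ m', (m, m') ∈ s
  · obtain ⟨m', hm'⟩ := hm
    exact ⟨m', by rwa [Set.insert_eq_of_mem hm']⟩
  have hmne : ∀ p ∈ s, p.1 ≠ m := fun p hp hpm => hm ⟨p.2, by rw [← hpm]; exact hp⟩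
  have := hs.to_subtype
  have e : Fin s.ncard ≃ s := (Finite.equivFinOfCardEq (Nat.card_coe_set_eq s)).symm
  set k := s.ncard
  have hy : Function.Injective fun i => (e i).1.2 := fun i j hij =>
    e.injective (Subtype.ext (Prod.ext
      ((h.eq_iff _ (e i).2 _ (e j).2).2 hij) hij))
  obtain ⟨m', hne, hm'⟩ := hS' (fun φ => S φ.1.1 fun j =>
    (Fin.snoc (fun i => (e i).1.1) m : Fin (k + 1) → M) (φ.1.2 j)) _ hy
  have hm'ne : ∀ p ∈ s, p.2 ≠ m' := fun p hp hpm =>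
    hne (e.symm ⟨p, hp⟩) (by simp [hpm])
  refine ⟨m', ⟨?_, fun R t ht => ?_⟩⟩
  · rintro p (rfl | hp) q (rfl | hq)
    · simp
    · exact iff_of_false (hmne q hq).symm (hm'ne q hq).symm
    · exact iff_of_false (hmne p hp) (hm'ne p hp)
    · exact h.eq_iff p hp q hq
  · by_cases hall : ∀ j, t j ∈ s
    · exact h.map_rel R t hall
    -- Tuple entries become variables; an entry outside `s` must become the last one, which makes
    -- the atom new.
    have hidx : ∀ j, ∃ c : Fin (k + 1),
        (Fin.snoc (fun i => (e i).1.1) m : Fin (k + 1) → M) c = (t j).1 ∧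
        (Fin.snoc (fun i => (e i).1.2) m' : Fin (k + 1) → M') c = (t j).2 ∧
        (t j ∉ s → c = Fin.last k) := by
      intro j
      rcases ht j with hj | hj
      · exact ⟨Fin.last k, by simp [hj], by simp [hj], fun _ => rfl⟩
      · exact ⟨(e.symm ⟨t j, hj⟩).castSucc, by simp, by simp, fun h => (h hj).elim⟩
    choose c hc₁ hc₂ hc₃ using hidx
    push Not at hall
    obtain ⟨j, hj⟩ := hall
    have := hm' ⟨⟨R, c⟩, j, hc₃ j hj⟩
    simp only [hc₁, hc₂] at this
    exact this.symm

theorem IsPartialIso.exists_insert_left (h : IsPartialIso S S' s) (hs : s.Finite)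
    (hS : ∀ f, S.Extends s.ncard f) (m' : M') :
    ∃ m : M, IsPartialIso S S' (insert (m, m') s) := by
  have hcard : (Prod.swap ⁻¹' s : Set (M' × M)).ncard = s.ncard := by
    rw [← Set.image_swap_eq_preimage_swap]
    exact Set.ncard_image_of_injective s Prod.swap_injective
  obtain ⟨m, hm⟩ := h.swap.exists_insert_right (hs.preimage Prod.swap_injective.injOn)
    (hcard ▸ hS) m'
  refine ⟨m, ?_⟩
  convert hm.swap using 1
  ext ⟨a, b⟩
  simp [and_comm]

/-- Partial isomorphisms with finite domain, ordered by inclusion. -/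
abbrev FinitePartialIso (S : AStructure A ar M) (S' : AStructure A ar M') :=
  {s : Set (M × M') // s.Finite ∧ IsPartialIso S S' s}

/-- The finite partial isomorphisms whose domain contains `m`. -/
def definedAtLeft (hS' : ∀ k f, S'.Extends k f) (m : M) : Order.Cofinal (FinitePartialIso S S') where
  carrier := {s | ∃ m', (m, m') ∈ s.1}
  isCofinal s := by
    obtain ⟨m', hm'⟩ := s.2.2.exists_insert_right s.2.1 (hS' _) m
    exact ⟨⟨_, s.2.1.insert _, hm'⟩, ⟨m', Set.mem_insert _ _⟩, Set.subset_insert _ _⟩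

/-- The finite partial isomorphisms whose range contains `m'`. -/
def definedAtRight (hS : ∀ k f, S.Extends k f) (m' : M') :
    Order.Cofinal (FinitePartialIso S S') where
  carrier := {s | ∃ m, (m, m') ∈ s.1}
  isCofinal s := by
    obtain ⟨m, hm⟩ := s.2.2.exists_insert_left s.2.1 (hS _) m'
    exact ⟨⟨_, s.2.1.insert _, hm⟩, ⟨m, Set.mem_insert _ _⟩, Set.subset_insert _ _⟩

/-- Back and forth: two countable structures that satisfy all extension axioms are isomorphic. -/
theorem exists_equiv_of_extends [Countable M] [Countable M'] (har : ∀ R, 0 < ar R)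
    (hS : ∀ k f, S.Extends k f) (hS' : ∀ k f, S'.Extends k f) :
    ∃ e : M ≃ M', ∀ R i, S' R (fun j => e (i j)) = S R i := by
  have := Encodable.ofCountable M
  have := Encodable.ofCountable M'
  let D : M ⊕ M' → Order.Cofinal (FinitePartialIso S S') :=
    Sum.elim (definedAtLeft hS') (definedAtRight hS)
  -- The union of this ideal is the graph of the isomorphism; meeting every member of `D` makes it
  -- total and surjective.
  let I := Order.idealOfCofinals (⟨∅, Set.finite_empty, IsPartialIso.empty har⟩ :
    FinitePartialIso S S') D
  have hl : ∀ m : M, ∃ m', ∃ s ∈ I, (m, m') ∈ s.1 := fun m => by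
    obtain ⟨s, ⟨m', hm'⟩, hs⟩ := Order.cofinal_meets_idealOfCofinals _ D (Sum.inl m)
    exact ⟨m', s, hs, hm'⟩
  have hr : ∀ m' : M', ∃ m, ∃ s ∈ I, (m, m') ∈ s.1 := fun m' => by
    obtain ⟨s, ⟨m, hm⟩, hs⟩ := Order.cofinal_meets_idealOfCofinals _ D (Sum.inr m')
    exact ⟨m, s, hs, hm⟩
  have heq : ∀ {a b : M} {a' b' : M'}, (∃ s ∈ I, (a, a') ∈ s.1) → (∃ s ∈ I, (b, b') ∈ s.1) →
      (a = b ↔ a' = b') := by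
    rintro a b a' b' ⟨s, hs, has⟩ ⟨t, ht, hbt⟩
    obtain ⟨r, -, hsr, htr⟩ := I.directed s hs t ht
    exact r.2.2.eq_iff _ (hsr has) _ (htr hbt)
  choose g hg using hl
  choose g' hg' using hr
  refine ⟨⟨g, g', fun m => (heq (hg' _) (hg m)).2 rfl, fun m' => (heq (hg _) (hg' m')).1 rfl⟩,
    fun R i => ?_⟩
  -- By directedness, finitely many pairs lie in a single member of the ideal.
  have : ∃ s ∈ I, ∀ j, (i j, g (i j)) ∈ s.1 := by
    choose s hs hsi using fun j => hg (i j)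
    have : Nonempty {s // s ∈ I} := I.nonempty.to_subtype
    obtain ⟨r, hr⟩ := (directedOn_iff_directed.1 I.directed).finite_le
      (fun j => (⟨s j, hs j⟩ : {s // s ∈ I}))
    exact ⟨r.1, r.2, fun j => hr j (hsi j)⟩
  obtain ⟨s, -, hs⟩ := this
  exact (s.2.2.map_rel R (fun j => (i j, g (i j))) hs).symm

end PartialIsomorphism

/-! ### Quantifier rank and preservation of values -/

section Value

variable {C : ℕ → Type u} {A : Type v} [LatticeAlgebra C A] [Finite A] {τ : Type w} {ar : τ → ℕ}
  {M : Type x} {M' : Type y}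

/-- The quantifier rank of a formula. -/
def Formula.rank : {n : ℕ} → Formula C ar n → ℕ
  | _, .rel _ _ => 0
  | _, .inf φ ψ => max φ.rank ψ.rank
  | _, .sup φ ψ => max φ.rank ψ.rank
  | _, .conn _ φ => Finset.univ.sup fun j => (φ j).rank
  | _, .all φ => φ.rank + 1
  | _, .ex φ => φ.rank + 1

theorem supValue_eq_of_range_eq {A : Type*} [Lattice A] [Finite A] [Nonempty M] [Nonempty M']
    {f : M → A} {g : M' → A} (h : Set.range f = Set.range g) : supValue f = supValue g :=
  (isLUB_supValue f).unique (h ▸ isLUB_supValue g)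

theorem infValue_eq_of_range_eq {A : Type*} [Lattice A] [Finite A] [Nonempty M] [Nonempty M']
    {f : M → A} {g : M' → A} (h : Set.range f = Set.range g) : infValue f = infValue g :=
  (isGLB_infValue f).unique (h ▸ isGLB_infValue g)

variable [Nonempty M] [Nonempty M'] {S : AStructure A ar M} {S' : AStructure A ar M'}

/-- A finite partial isomorphism preserves the values of formulas of small quantifier rank. -/
theorem IsPartialIso.value_eq {K : ℕ} (hS : ∀ k < K, ∀ f, S.Extends k f)
    (hS' : ∀ k < K, ∀ f, S'.Extends k f) {n : ℕ} (φ : Formula C ar n) {s : Set (M × M')}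
    (h : IsPartialIso S S' s) (hs : s.Finite) (hK : s.ncard + φ.rank ≤ K) {x : Fin n → M}
    {x' : Fin n → M'} (hx : ∀ i, (x i, x' i) ∈ s) : φ.value S x = φ.value S' x' := by
  -- Serves both quantifiers: stripping one lowers the rank by one, which pays for the added pair
  -- within the budget `K`.
  have range_eq : ∀ {n : ℕ} (φ : Formula C ar (n + 1)),
      (∀ {s : Set (M × M')}, IsPartialIso S S' s → s.Finite → s.ncard + φ.rank ≤ K →
        ∀ {x : Fin (n + 1) → M} {x' : Fin (n + 1) → M'}, (∀ i, (x i, x' i) ∈ s) →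
          φ.value S x = φ.value S' x') →
      ∀ {s : Set (M × M')}, IsPartialIso S S' s → s.Finite → s.ncard + (φ.rank + 1) ≤ K →
        ∀ {x : Fin n → M} {x' : Fin n → M'}, (∀ i, (x i, x' i) ∈ s) →
          Set.range (fun m => φ.value S (Fin.snoc x m)) =
            Set.range fun m => φ.value S' (Fin.snoc x' m) := by
    intro n φ ih s h hs hK x x' hx
    have key : ∀ m m', IsPartialIso S S' (insert (m, m') s) →
        φ.value S (Fin.snoc x m) = φ.value S' (Fin.snoc x' m') := fun m m' hm => by
      refine ih hm (hs.insert _) (by have := Set.ncard_insert_le (m, m') s; omega) fun i => ?_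
      refine Fin.lastCases ?_ (fun i => ?_) i
      · simp
      · simpa using Or.inr (hx i)
    ext a
    constructor
    · rintro ⟨m, rfl⟩
      obtain ⟨m', hm'⟩ := h.exists_insert_right hs (hS' _ (by omega)) m
      exact ⟨m', (key m m' hm').symm⟩
    · rintro ⟨m', rfl⟩
      obtain ⟨m, hm⟩ := h.exists_insert_left hs (hS _ (by omega)) m'
      exact ⟨m, key m m' hm⟩
  induction φ generalizing s with
  | rel R t => exact h.map_rel R (fun j => (x (t j), x' (t j))) fun j => hx _
  | inf φ ψ hφ hψ =>
    simp only [Formula.rank] at hK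
    simp only [Formula.value]
    rw [hφ h hs (by omega) hx, hψ h hs (by omega) hx]
  | sup φ ψ hφ hψ =>
    simp only [Formula.rank] at hK
    simp only [Formula.value]
    rw [hφ h hs (by omega) hx, hψ h hs (by omega) hx]
  | conn c φ ih =>
    simp only [Formula.rank] at hK
    simp only [Formula.value]
    congr 1
    funext j
    refine ih j h hs (le_trans ?_ hK) hx
    gcongr
    exact Finset.le_sup (f := fun j => (φ j).rank) (Finset.mem_univ j)
  | all φ ih => exact infValue_eq_of_range_eq (range_eq φ ih h hs hK hx)
  | ex φ ih => exact supValue_eq_of_range_eq (range_eq φ ih h hs hK hx)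

theorem Sentence.value_eq_of_extends (har : ∀ R, 0 < ar R) (φ : Sentence C ar)
    (hS : ∀ k < φ.rank, ∀ f, S.Extends k f) (hS' : ∀ k < φ.rank, ∀ f, S'.Extends k f) :
    Sentence.value S φ = Sentence.value S' φ :=
  IsPartialIso.value_eq hS hS' φ (IsPartialIso.empty har) Set.finite_empty (by simp)
    fun i => i.elim0

end Value

/-! ### Construction of the random structure on `ℕ` -/

section RandomStructure

variable {A : Type v} [Finite A] [Nonempty A] {τ : Type w} [Finite τ] {ar : τ → ℕ}

instance (k : ℕ) : Finite (NewAtom ar k) := by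
  unfold NewAtom
  infer_instance

variable (A ar) in
/-- An instance of an extension axiom over the domain `ℕ`. -/
abbrev ExtensionTask : Type max v w :=
  Σ k, (Fin k → ℕ) × (NewAtom ar k → A)

/-- An enumeration of all extension tasks, in which each of them has arbitrarily large indices. -/
theorem exists_enumeration (α : Type*) [Countable α] :
    ∃ g : ℕ → Option α, ∀ a n, ∃ m > n, g m = some a := by
  have := Encodable.ofCountable α
  refine ⟨fun m => (Encodable.decode (α := α × ℕ) m).map Prod.fst, fun a n => ?_⟩
  obtain ⟨_, ⟨l, rfl⟩, hl⟩ := (Set.infinite_range_of_injective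
    (f := fun l : ℕ => Encodable.encode (a, l)) fun l l' h => by simpa using h).exists_gt n
  exact ⟨_, hl, by simp⟩

theorem snoc_injective {M : Type*} {k : ℕ} {x : Fin k → M} (hx : Function.Injective x) {y : M}
    (hy : ∀ i, y ≠ x i) : Function.Injective (Fin.snoc x y : Fin (k + 1) → M) :=
  Fin.snoc_injective_iff.2 ⟨hx, fun ⟨i, hi⟩ => hy i hi.symm⟩

/-- An `A`-valued structure with domain `ℕ` that satisfies all extension axioms. -/
theorem exists_structure_extends :
    ∃ S : AStructure A ar ℕ, ∀ k f, S.Extends k f := by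
  classical
  obtain ⟨g, hg⟩ := exists_enumeration (ExtensionTask A ar)
  have a₀ : A := Classical.arbitrary A
  -- A tuple with maximum `m` gets the value demanded by task number `m` with `m` as new element,
  -- and `a₀` if there is no demand.
  let IsValue (R : τ) (i : Fin (ar R) → ℕ) (a : A) : Prop :=
    ∃ q ∈ g (Finset.univ.sup i), ∃ φ : NewAtom ar q.1, ∃ h : φ.1.1 = R,
      (∀ j, i (Fin.cast (by rw [h]) j) =
        (Fin.snoc q.2.1 (Finset.univ.sup i) : Fin (q.1 + 1) → ℕ) (φ.1.2 j)) ∧ q.2.2 φ = a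
  refine ⟨fun R i => if h : ∃ a, IsValue R i a then h.choose else a₀, fun k f x hx => ?_⟩
  -- Since tasks recur, `m` can be taken above all entries of `x`; it is then new and is the maximum
  -- of every tuple containing it.
  obtain ⟨m, hm, hgm⟩ := hg ⟨k, x, f⟩ (Finset.univ.sup x)
  have hlt : ∀ i, x i < m := fun i => (Finset.le_sup (Finset.mem_univ i)).trans_lt hm
  refine ⟨m, fun i => (hlt i).ne', fun φ => ?_⟩
  have hinj := snoc_injective hx fun i => (hlt i).ne'
  set i : Fin (ar φ.1.1) → ℕ := fun j => (Fin.snoc x m : Fin (k + 1) → ℕ) (φ.1.2 j)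
  have hsup : Finset.univ.sup i = m := by
    refine le_antisymm (Finset.sup_le fun j _ => ?_) ?_
    · refine Fin.lastCases (motive := fun c => (Fin.snoc x m : Fin (k + 1) → ℕ) c ≤ m) ?_ ?_
        (φ.1.2 j)
      · simp
      · intro c
        simpa using (hlt c).le
    · obtain ⟨j, hj⟩ := φ.2
      have : i j = m := by simp [i, hj]
      exact this ▸ Finset.le_sup (Finset.mem_univ j)
  have hex : ∃ a, IsValue φ.1.1 i a :=
    ⟨f φ, ⟨k, x, f⟩, by rw [hsup, hgm]; rfl, φ, rfl, fun j => by rw [hsup]; rfl, rfl⟩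
  -- Demands never conflict: the maximum determines the task, and injectivity of the extended tuple
  -- determines the atom.
  have huniq : ∀ a, IsValue φ.1.1 i a → a = f φ := by
    rintro a ⟨q, hq, ψ, hR, hi, rfl⟩
    rw [hsup, hgm] at hq
    obtain rfl : (⟨k, x, f⟩ : ExtensionTask A ar) = q := by simpa using hq
    obtain ⟨⟨R, t⟩, ht⟩ := φ
    obtain ⟨⟨R', t'⟩, ht'⟩ := ψ
    obtain rfl : R' = R := hR
    rw [hsup] at hi
    have : t' = t := funext fun j => (hinj (hi j)).symm
    subst this
    rfl
  simp only [dif_pos hex]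
  exact huniq _ hex.choose_spec

end RandomStructure

/-! ### Probability of the extension axioms -/

section Probability

/-- In a product of finite probability spaces, the probability that no block `B y` agrees with the
target and that the block `D` does agree with it. -/
theorem sum_prod_mul_prod_one_sub {ι : Type*} [Fintype ι] [DecidableEq ι] {A : Type*} [Fintype A]
    [DecidableEq A] {Y : Type*} (p : ι → A → ℝ) (hp : ∀ c, ∑ a, p c a = 1) (t : ι → A)
    (B : Y → Finset ι) (s : Finset Y) (hB : (s : Set Y).PairwiseDisjoint B) (D : Finset ι)
    (hD : ∀ y ∈ s, Disjoint (B y) D) :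
    ∑ ω : ι → A, (∏ c, p c (ω c)) * ((∏ y ∈ s, (1 - ∏ c ∈ B y, if ω c = t c then 1 else 0)) *
      ∏ c ∈ D, if ω c = t c then 1 else 0) =
    (∏ y ∈ s, (1 - ∏ c ∈ B y, p c (t c))) * ∏ c ∈ D, p c (t c) := by
  classical
  -- `D` must vary: expanding the factor for a new `y` uses the hypothesis for `D` and for `B y ∪
  -- D`.
  induction s using Finset.induction_on generalizing D with
  | empty =>
    simp only [Finset.prod_empty, one_mul]
    have : ∀ ω : ι → A, (∏ c, p c (ω c)) * (∏ c ∈ D, if ω c = t c then 1 else 0) =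
        ∏ c, p c (ω c) * (if c ∈ D then if ω c = t c then 1 else 0 else 1) := fun ω => by
      rw [Finset.prod_mul_distrib, Fintype.prod_ite_mem]
    simp_rw [this]
    rw [← Fintype.prod_sum fun c a => p c a * (if c ∈ D then if a = t c then 1 else 0 else 1),
      ← Fintype.prod_ite_mem D]
    refine Finset.prod_congr rfl fun c _ => ?_
    split_ifs <;> simp [hp]
  | insert y s hy ih =>
    have hB' : (s : Set Y).PairwiseDisjoint B := hB.subset (by simp)
    have hDs : ∀ z ∈ s, Disjoint (B z) D := fun z hz => hD z (Finset.mem_insert_of_mem hz)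
    have hys : ∀ z ∈ s, Disjoint (B z) (B y ∪ D) := fun z hz =>
      Finset.disjoint_union_right.2 ⟨hB (by simp [hz]) (by simp) (by rintro rfl; exact hy hz),
        hDs z hz⟩
    have hyD : Disjoint (B y) D := hD y (Finset.mem_insert_self _ _)
    have h₁ := ih hB' D hDs
    have h₂ := ih hB' (B y ∪ D) hys
    simp only [Finset.prod_union hyD] at h₂
    simp only [Finset.prod_insert hy]
    have h := congrArg₂ (· - ·) h₁ h₂
    simp only [← Finset.sum_sub_distrib] at h
    refine Eq.trans (Finset.sum_congr rfl fun ω _ => ?_) (h.trans ?_) <;> ring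

open Filter in
theorem tendsto_pow_mul_pow_sub (k : ℕ) {r : ℝ} (h₀ : 0 ≤ r) (h₁ : r < 1) :
    Tendsto (fun n : ℕ => (n : ℝ) ^ k * r ^ (n - k)) atTop (nhds 0) := by
  -- The shift turns the truncated exponent into `n + 1`; then `n + k + 1 ≤ (k + 1) * (n + 1)`
  -- reduces to a standard limit.
  rw [← tendsto_add_atTop_iff_nat (k + 1)]
  have h := ((tendsto_pow_const_mul_const_pow_of_abs_lt_one k
    (by rwa [abs_of_nonneg h₀])).comp (tendsto_add_atTop_nat 1)).const_mul (((k : ℝ) + 1) ^ k)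
  rw [mul_zero] at h
  refine squeeze_zero (fun n => by positivity) (fun n => ?_) h
  have : n + (k + 1) - k = n + 1 := by omega
  rw [this, Function.comp_apply, ← mul_assoc, ← mul_pow]
  gcongr
  push_cast
  nlinarith [(Nat.cast_nonneg n : (0 : ℝ) ≤ n), (Nat.cast_nonneg k : (0 : ℝ) ≤ k),
    mul_nonneg (Nat.cast_nonneg n : (0 : ℝ) ≤ n) (Nat.cast_nonneg k : (0 : ℝ) ≤ k)]

variable {A : Type v} {τ : Type w} [Fintype τ] {ar : τ → ℕ} {p : τ → A → ℝ} {D : Type x}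
  [Fintype D]

theorem structureProb_nonneg (hp : ∀ R a, 0 < p R a) (S : AStructure A ar D) :
    0 ≤ structureProb p S :=
  Finset.prod_nonneg fun _ _ => Finset.prod_nonneg fun _ _ => (hp _ _).le

variable [Fintype A]

open Classical in
/-- The probability that a random `A`-valued structure with domain `D` has a given property. -/
noncomputable def probability (p : τ → A → ℝ) (P : AStructure A ar D → Prop) : ℝ :=
  ∑ S : AStructure A ar D with P S, structureProb p S

-- Uncurrying makes a structure a single function on atomic statements, as
-- `sum_prod_mul_prod_one_sub` requires.
open Classical in
theorem sum_structureProb_mul (F : AStructure A ar D → ℝ) :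
    ∑ S, structureProb p S * F S =
      ∑ ω : (Σ R, Fin (ar R) → D) → A, (∏ c, p c.1 (ω c)) * F fun R i => ω ⟨R, i⟩ := by
  refine (Fintype.sum_equiv (Equiv.piCurry fun (R : τ) (_ : Fin (ar R) → D) => A) _ _
    fun ω => ?_).symm
  rw [structureProb, Fintype.prod_sigma]
  rfl

theorem probability_nonneg (hp : ∀ R a, 0 < p R a) (P : AStructure A ar D → Prop) :
    0 ≤ probability p P :=
  Finset.sum_nonneg fun S _ => structureProb_nonneg hp S

theorem probability_mono (hp : ∀ R a, 0 < p R a) {P Q : AStructure A ar D → Prop}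
    (h : ∀ S, P S → Q S) : probability p P ≤ probability p Q :=
  Finset.sum_le_sum_of_subset_of_nonneg
    (fun S => by simpa using h S) fun S _ _ => structureProb_nonneg hp S

open Classical in
theorem probability_eq_sum_mul_ite (P : AStructure A ar D → Prop) :
    probability p P = ∑ S : AStructure A ar D, structureProb p S * if P S then 1 else 0 := by
  simp [probability, Finset.sum_filter]

theorem probability_exists_le (hp : ∀ R a, 0 < p R a) {ι : Type*} (s : Finset ι)
    (P : ι → AStructure A ar D → Prop) :
    probability p (fun S => ∃ i ∈ s, P i S) ≤ ∑ i ∈ s, probability p (P i) := by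
  classical
  simp only [probability_eq_sum_mul_ite]
  rw [Finset.sum_comm]
  refine Finset.sum_le_sum fun S _ => ?_
  rw [← Finset.mul_sum]
  refine mul_le_mul_of_nonneg_left ?_ (structureProb_nonneg hp S)
  have h0 : ∀ i ∈ s, (0 : ℝ) ≤ if P i S then 1 else 0 := fun i _ => by split_ifs <;> simp
  split_ifs with h
  · obtain ⟨i, hi, hP⟩ := h
    simpa [hP] using Finset.single_le_sum h0 hi
  · exact Finset.sum_nonneg h0

theorem probability_add_probability_not (hp₁ : ∀ R, ∑ a, p R a = 1)
    (P : AStructure A ar D → Prop) :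
    probability p P + probability p (fun S => ¬ P S) = 1 := by
  classical
  have h : ∑ S : AStructure A ar D, structureProb p S = 1 := by
    have := sum_structureProb_mul (p := p) (ar := ar) (D := D) fun _ => 1
    simp only [mul_one] at this
    rw [this, ← Fintype.prod_sum fun (c : Σ R, Fin (ar R) → D) a => p c.1 a]
    simp [hp₁]
  rw [← h, ← Finset.sum_filter_add_sum_filter_not _ P]
  unfold probability
  congr!

/-- The probability that no element `y` realises the extension of the tuple `x` given by `f`. -/
theorem probability_not_extends_at (hp₁ : ∀ R, ∑ a, p R a = 1) [Nonempty A]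
    {k : ℕ} [Fintype (NewAtom ar k)] (f : NewAtom ar k → A) {x : Fin k → D}
    (hx : Function.Injective x) :
    probability p (fun S : AStructure A ar D => ¬ ∃ y : D, (∀ i, y ≠ x i) ∧ ∀ φ : NewAtom ar k,
        S φ.1.1 (fun j => (Fin.snoc x y : Fin (k + 1) → D) (φ.1.2 j)) = f φ) =
      (1 - ∏ φ : NewAtom ar k, p φ.1.1 (f φ)) ^ (Fintype.card D - k) := by
  classical
  let Y := {y : D // y ∉ Set.range x}
  let c : Y × NewAtom ar k → Σ R, Fin (ar R) → D := fun b =>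
    ⟨b.2.1.1, fun j => (Fin.snoc x b.1.1 : Fin (k + 1) → D) (b.2.1.2 j)⟩
  -- The position of the last variable reveals `y`, as `y` lies outside the range of `x`; then the
  -- whole atom is determined. This gives disjoint blocks.
  have hc : Function.Injective c := by
    rintro ⟨⟨y, hy⟩, ⟨⟨R, t⟩, j, hj⟩⟩ ⟨⟨y', hy'⟩, ⟨⟨R', t'⟩, j', hj'⟩⟩ h
    simp only [c, Sigma.mk.injEq] at h
    obtain ⟨rfl, h⟩ := h
    rw [heq_eq_eq] at h
    have hyy' : y = y' := by
      have h₁ := congrFun h j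
      simp only at hj hj'
      rw [hj, Fin.snoc_last] at h₁
      rcases Fin.eq_castSucc_or_eq_last (t' j) with ⟨i, hi⟩ | hi
      · rw [hi, Fin.snoc_castSucc] at h₁
        exact (hy ⟨i, h₁.symm⟩).elim
      · rwa [hi, Fin.snoc_last] at h₁
    subst hyy'
    have : t = t' := funext fun j =>
      snoc_injective hx (fun i hi => hy ⟨i, hi.symm⟩) (congrFun h j)
    subst this
    rfl
  -- The default value is irrelevant, since all blocks lie in the range of `c`.
  let t := Function.extend c (fun b => f b.2) fun _ => Classical.arbitrary A
  have ht : ∀ y φ, t (c (y, φ)) = f φ := fun y φ => hc.extend_apply _ _ (y, φ)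
  let B : Y → Finset (Σ R, Fin (ar R) → D) := fun y => Finset.univ.image fun φ => c (y, φ)
  have hB : ∀ (y : Y) (F : (Σ R, Fin (ar R) → D) → ℝ), ∏ d ∈ B y, F d = ∏ φ, F (c (y, φ)) :=
    fun y F => Finset.prod_image fun φ _ ψ _ h => (Prod.mk.inj (hc h)).2
  have hdisj : ((Finset.univ : Finset Y) : Set Y).PairwiseDisjoint B := by
    intro y _ y' _ hne
    refine Finset.disjoint_left.2 fun d hd hd' => ?_
    simp only [B, Finset.mem_image, Finset.mem_univ, true_and] at hd hd'
    obtain ⟨φ, rfl⟩ := hd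
    obtain ⟨ψ, h⟩ := hd'
    exact hne (Prod.mk.inj (hc h)).1.symm
  have key := sum_prod_mul_prod_one_sub (fun d : Σ R, Fin (ar R) → D => p d.1) (fun d => hp₁ d.1) t B
    Finset.univ hdisj ∅ (by simp)
  simp only [Finset.prod_empty, mul_one, hB, ht] at key
  have hcard : Fintype.card Y = Fintype.card D - k := by
    rw [Fintype.card_subtype_compl, ← Set.toFinset_card, Set.toFinset_range,
      Finset.card_image_of_injective _ hx, Finset.card_univ, Fintype.card_fin]
  rw [probability_eq_sum_mul_ite, sum_structureProb_mul]
  change _ = ∏ _y : Y, (1 - ∏ φ : NewAtom ar k, p φ.1.1 (f φ)) at key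
  rw [Finset.prod_const, Finset.card_univ, hcard] at key
  rw [← key]
  refine Finset.sum_congr rfl fun ω _ => ?_
  congr 1
  simp only [Finset.prod_ite_zero, Finset.prod_const_one, Finset.mem_univ, true_implies]
  have : ∀ y : Y, (1 - if ∀ φ, ω (c (y, φ)) = f φ then (1 : ℝ) else 0) =
      if ¬ ∀ φ, ω (c (y, φ)) = f φ then 1 else 0 := fun y => by split_ifs <;> simp_all
  simp only [this, Finset.prod_ite_zero, Finset.prod_const_one, Finset.mem_univ, true_implies]
  congr 1
  rw [eq_iff_iff]
  constructor
  · exact fun h y hy => h ⟨y.1, fun i hi => y.2 ⟨i, hi.symm⟩, hy⟩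
  · rintro h ⟨y, hy, hφ⟩
    exact h ⟨y, fun ⟨i, hi⟩ => hy i hi.symm⟩ hφ

/-- Union bound over the injective tuples, at most `n ^ k` in number. -/
theorem probability_not_extends_le (hp : ∀ R a, 0 < p R a) (hp₁ : ∀ R, ∑ a, p R a = 1) [Nonempty A]
    {k : ℕ} [Fintype (NewAtom ar k)] (f : NewAtom ar k → A) (n : ℕ) :
    probability p (fun S : AStructure A ar (Fin n) => ¬ S.Extends k f) ≤
      (n : ℝ) ^ k * (1 - ∏ φ : NewAtom ar k, p φ.1.1 (f φ)) ^ (n - k) := by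
  classical
  have h01 : 0 ≤ 1 - ∏ φ : NewAtom ar k, p φ.1.1 (f φ) :=
    sub_nonneg.2 (Finset.prod_le_one (fun _ _ => (hp _ _).le) fun φ _ => (hp₁ φ.1.1) ▸
      Finset.single_le_sum (f := p φ.1.1) (fun a _ => (hp _ a).le) (Finset.mem_univ _))
  set r := 1 - ∏ φ : NewAtom ar k, p φ.1.1 (f φ)
  let s := Finset.univ.filter fun x : Fin k → Fin n => Function.Injective x
  calc _ ≤ probability p (fun S : AStructure A ar (Fin n) => ∃ x ∈ s, ¬ ∃ y : Fin n,
          (∀ i, y ≠ x i) ∧ ∀ φ : NewAtom ar k,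
            S φ.1.1 (fun j => (Fin.snoc x y : Fin (k + 1) → Fin n) (φ.1.2 j)) = f φ) := by
        refine probability_mono hp fun S hS => ?_
        unfold AStructure.Extends at hS
        push Not at hS
        obtain ⟨x, hx, h⟩ := hS
        exact ⟨x, by simpa [s] using hx, by push Not; exact h⟩
    _ ≤ ∑ x ∈ s, r ^ (n - k) := by
        refine (probability_exists_le hp s _).trans (Finset.sum_le_sum fun x hx => ?_)
        rw [probability_not_extends_at hp₁ f (Finset.mem_filter.1 hx).2, Fintype.card_fin]
    _ ≤ ∑ x : Fin k → Fin n, r ^ (n - k) :=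
        Finset.sum_le_sum_of_subset_of_nonneg (Finset.subset_univ _) fun _ _ _ => pow_nonneg h01 _
    _ = _ := by simp

open Filter in
/-- Every extension axiom holds in almost all finite structures. -/
theorem tendsto_probability_not_extends (hp : ∀ R a, 0 < p R a) (hp₁ : ∀ R, ∑ a, p R a = 1)
    [Nonempty A] (k : ℕ) (f : NewAtom ar k → A) :
    Tendsto (fun n => probability p (fun S : AStructure A ar (Fin n) => ¬ S.Extends k f))
      atTop (nhds 0) := by
  have := Fintype.ofFinite (NewAtom ar k)
  refine squeeze_zero (fun n => probability_nonneg hp _)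
    (fun n => probability_not_extends_le hp hp₁ f n) (tendsto_pow_mul_pow_sub k ?_ ?_)
  · exact sub_nonneg.2 (Finset.prod_le_one (fun _ _ => (hp _ _).le) fun φ _ => (hp₁ φ.1.1) ▸
      Finset.single_le_sum (f := p φ.1.1) (fun a _ => (hp _ a).le) (Finset.mem_univ _))
  · exact sub_lt_self _ (Finset.prod_pos fun _ _ => hp _ _)

-- Only finitely many axioms are involved, because `A` and each `NewAtom ar k` are finite.
open Filter in
theorem tendsto_probability_not_forall_extends (hp : ∀ R a, 0 < p R a)
    (hp₁ : ∀ R, ∑ a, p R a = 1) [Nonempty A] (K : ℕ) :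
    Tendsto (fun n => probability p
      (fun S : AStructure A ar (Fin n) => ¬ ∀ k < K, ∀ f, S.Extends k f)) atTop (nhds 0) := by
  classical
  have := fun k => Fintype.ofFinite (NewAtom ar k)
  let s : Finset (Σ k, NewAtom ar k → A) := (Finset.range K).sigma fun _ => Finset.univ
  have h := tendsto_finsetSum s fun q _ => tendsto_probability_not_extends hp hp₁ q.1 q.2
  rw [Finset.sum_const_zero] at h
  refine squeeze_zero (fun n => probability_nonneg hp _) (fun n => ?_) h
  refine (probability_mono hp fun S hS => ?_).trans (probability_exists_le hp s _)
  push Not at hS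
  obtain ⟨k, hk, f, hf⟩ := hS
  exact ⟨⟨k, f⟩, by simpa [s] using hk, hf⟩

end Probability

/-! ### The zero-one law -/

section ZeroOneLaw

variable {C : ℕ → Type u} {A : Type v} [LatticeAlgebra C A] [Fintype A] {τ : Type w} [Fintype τ]
  {ar : τ → ℕ} {p : τ → A → ℝ}

theorem mu_eq_probability (n : ℕ) [NeZero n] (φ : Sentence C ar) (a : A) :
    mu p n φ a = probability p fun T : AStructure A ar (Fin n) => Sentence.value T φ = a := by
  unfold mu probability
  congr!

variable [Nonempty A] {M : Type x} [Nonempty M] {S : AStructure A ar M}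

open Filter in
theorem tendsto_probability_value_ne (har : ∀ R, 0 < ar R) (hS : ∀ k f, S.Extends k f)
    (hp : ∀ R a, 0 < p R a) (hp₁ : ∀ R, ∑ a, p R a = 1) (φ : Sentence C ar) :
    Tendsto (fun n : ℕ => probability p fun T : AStructure A ar (Fin (n + 1)) =>
      ¬ Sentence.value T φ = Sentence.value S φ) atTop (nhds 0) := by
  refine squeeze_zero (fun n => probability_nonneg hp _) (fun n => ?_)
    ((tendsto_probability_not_forall_extends (ar := ar) hp hp₁ φ.rank).comp (tendsto_add_atTop_nat 1))
  exact probability_mono hp fun T hT h =>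
    hT (Sentence.value_eq_of_extends har φ h fun k _ => hS k)

open Filter in
/-- The zero-one law: the almost sure value of a sentence is its value in a random structure. -/
theorem tendsto_mu_iff (har : ∀ R, 0 < ar R) (hS : ∀ k f, S.Extends k f)
    (hp : ∀ R a, 0 < p R a) (hp₁ : ∀ R, ∑ a, p R a = 1) (φ : Sentence C ar) (a : A) :
    Tendsto (fun n : ℕ => mu p (n + 1) φ a) atTop (nhds 1) ↔ Sentence.value S φ = a := by
  simp only [mu_eq_probability]
  have hne := tendsto_probability_value_ne (p := p) har hS hp hp₁ φ
  constructor
  · intro h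
    by_contra hva
    have h₀ : Tendsto (fun n : ℕ => probability p fun T : AStructure A ar (Fin (n + 1)) =>
        Sentence.value T φ = a) atTop (nhds 0) := by
      refine squeeze_zero (fun n => probability_nonneg hp _) (fun n => ?_) hne
      exact probability_mono hp fun T hT h' => hva (h'.symm.trans hT)
    exact zero_ne_one (tendsto_nhds_unique h₀ h)
  · rintro rfl
    have h := hne.const_sub 1
    rw [sub_zero] at h
    refine h.congr fun n => ?_
    rw [← probability_add_probability_not hp₁ fun T : AStructure A ar (Fin (n + 1)) =>
      Sentence.value T φ = Sentence.value S φ, add_sub_cancel_right]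

end ZeroOneLaw

end ManyValued

theorem mainTheorem3 {C : ℕ → Type*} {A : Type*} [ManyValued.LatticeAlgebra C A] [Fintype A]
    [Nonempty A] {τ : Type*} [Fintype τ] (ar : τ → ℕ) (har : ∀ R, 0 < ar R) :
    ∃ (M : Type) (_ : Nonempty M) (S : ManyValued.AStructure A ar M),
      Countable M ∧
      ManyValued.IsCountableRandomModel S.toClassical ∧
      (∀ (M' : Type) (N' : (ManyValued.classicalLanguage A ar).Structure M'),
        ManyValued.IsCountableRandomModel N' →
          Nonempty (@FirstOrder.Language.Equiv (ManyValued.classicalLanguage A ar) M M'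
            S.toClassical N')) ∧
      ∀ p : τ → A → ℝ, (∀ R a, 0 < p R a) → (∀ R, ∑ a, p R a = 1) →
        ∀ (φ : ManyValued.Sentence C ar) (a : A),
          Filter.Tendsto (fun n : ℕ => ManyValued.mu p (n + 1) φ a) Filter.atTop (nhds 1) ↔
            ManyValued.Sentence.value S φ = a := by
  obtain ⟨S, hS⟩ := ManyValued.exists_structure_extends (A := A) (ar := ar)
  refine ⟨ℕ, inferInstance, S, inferInstance, ⟨inferInstance, S.inTranslatedClass_toClassical, hS⟩,
    fun M' N' hN' => ?_, fun p hp hp₁ φ a => ManyValued.tendsto_mu_iff har hS hp hp₁ φ a⟩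
  -- Back and forth works with values, so `N'` is first read as an `A`-valued structure.
  obtain ⟨S', hS'⟩ := hN'.mem_class.exists_valued
  have := hN'.countable
  obtain ⟨e, he⟩ := ManyValued.exists_equiv_of_extends har hS (S' := S') fun k f x hx => by
    obtain ⟨y, hy, h⟩ := hN'.extension k f x hx
    exact ⟨y, hy, fun φ => (hS' _ _ _).1 (h φ)⟩
  let _ := S.toClassical
  refine ⟨⟨e, fun c => c.elim, ?_⟩⟩
  rintro n ⟨⟨R, rfl⟩, a⟩ i
  refine (hS' R a (e ∘ i)).trans ?_
  rw [show S' R (e ∘ i) = S R i from he R i]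
  rfl
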